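/- Let $\alpha\in(0,\infty)$, $B\in(0,\infty)$ and $d,M\in\mathbb N$. Let $\sigma:\mathbb R\to\mathbb R$ be a differentiable function that is not a polynomial and is slowly increasing, i.e. $\lim_{x\to\infty}\sigma(x)/x^{a}=0$ for every $a>0$. Let $\mu_0$ be a probability measure on $\mathbb R\times\mathbb R^{d}$, the law of a pair $(c,w)$, such that $c\in[-B,B]$ holds $\mu_0$-almost surely and $\mu_0(\Gamma)>0$ for every measurable set $\Gamma\subset[-B,B]\times\mathbb R^{d}$ of positive Lebesgue measure. Let $\zeta^{(1)},\dots,\zeta^{(M)}\in\mathbb R^{d}$ be in distinct directions, i.e. they are nonzero and no two of them (with different indices) lie on the same line through the origin. Writing $\langle f,\mu_0\rangle=\int f(c,w)\,\mu_0(dc,dw)$, consider the $M\times M$ matrix $A$ with entries $$A_{\zeta,\zeta'}=\alpha\,\langle\sigma(w\cdot\zeta')\,\sigma(w\cdot\zeta),\mu_0\rangle+\alpha\,\langle c^{2}\,\sigma'(w\cdot\zeta')\,\sigma'(w\cdot\zeta)\,\zeta\cdot\zeta',\mu_0\rangle,\qquad \zeta,\zeta'\in\{\zeta^{(1)},\dots,\zeta^{(M)}\},$$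 and assume that all the integrals that define $A$ are absolutely convergent (as is the case, for example, when $\sigma$ and $\sigma'$ are bounded). Then $A$ is (symmetric) positive definite. -/

import Mathlib

open MeasureTheory Filter Topology
open scoped RealInnerProductSpace

/-- `σ` is slowly increasing: `σ(x) / x ^ a → 0` as `x → ∞`, for every real `a > 0`. -/
def SlowlyIncreasing (σ : ℝ → ℝ) : Prop :=
  ∀ a : ℝ, 0 < a → Tendsto (fun x : ℝ => σ x / x ^ a) atTop (𝓝 0)

/-- `σ` is not (the function of) a real polynomial. -/
def NonPolynomial (σ : ℝ → ℝ) : Prop :=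
  ¬ ∃ p : Polynomial ℝ, ∀ x : ℝ, σ x = p.eval x

/-- The vectors are nonzero and no two of them lie on the same line through the origin. -/
def InDistinctDirections {d M : ℕ} (ζ : Fin M → EuclideanSpace ℝ (Fin d)) : Prop :=
  (∀ i, ζ i ≠ 0) ∧ ∀ i j, i ≠ j → ∀ t : ℝ, ζ i ≠ t • ζ j

/-- The law `μ₀` of the initial parameters `(c, w)`: `c` takes values in `[-B, B]`, and every
measurable subset of `[-B, B] × ℝ^d` of positive Lebesgue measure has positive mass. -/
def HasFullInitialSupport {d : ℕ} (B : ℝ) (μ₀ : Measure (ℝ × EuclideanSpace ℝ (Fin d))) : Prop :=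
  (∀ᵐ p ∂μ₀, p.1 ∈ Set.Icc (-B) B) ∧
    ∀ Γ : Set (ℝ × EuclideanSpace ℝ (Fin d)), MeasurableSet Γ →
      Γ ⊆ Set.Icc (-B) B ×ˢ Set.univ → 0 < volume Γ → 0 < μ₀ Γ

/-- The integrand of the first bracket of the matrix, at `p = (c, w)`. -/
noncomputable def outerIntegrand {d : ℕ} (σ : ℝ → ℝ) (x y : EuclideanSpace ℝ (Fin d))
    (p : ℝ × EuclideanSpace ℝ (Fin d)) : ℝ :=
  σ ⟪p.2, y⟫ * σ ⟪p.2, x⟫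

/-- The integrand of the second bracket of the matrix, at `p = (c, w)`. -/
noncomputable def innerIntegrand {d : ℕ} (σ : ℝ → ℝ) (x y : EuclideanSpace ℝ (Fin d))
    (p : ℝ × EuclideanSpace ℝ (Fin d)) : ℝ :=
  p.1 ^ 2 * deriv σ ⟪p.2, y⟫ * deriv σ ⟪p.2, x⟫ * ⟪x, y⟫

/-- The `M × M` matrix `A` with rows and columns indexed by the points `ζ i`. -/
noncomputable def limitMatrix {d M : ℕ} (α : ℝ) (σ : ℝ → ℝ)
    (μ₀ : Measure (ℝ × EuclideanSpace ℝ (Fin d))) (ζ : Fin M → EuclideanSpace ℝ (Fin d)) :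
    Matrix (Fin M) (Fin M) ℝ :=
  Matrix.of fun i j =>
    α * (∫ p, outerIntegrand σ (ζ i) (ζ j) p ∂μ₀) + α * (∫ p, innerIntegrand σ (ζ i) (ζ j) p ∂μ₀)

/-! The quadratic form at `v` is `α` times the mean of `(∑ v i σ(w·ζ i))²` plus a nonnegative term
from `σ'`. If the mean is zero, full support and continuity give `∑ v i σ(w·ζ i) = 0` for every `w`.
Shifting `w` orthogonally to one `ζ j` and subtracting removes that term and replaces the other
profiles by their differences. Once all terms but the `i`-th are removed, the differences of some
fixed order of `v i σ` vanish for every step, so by Fréchet's theorem `v i σ` is a polynomial, which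
forces `v i = 0`. -/

/-- A function whose `n`-th difference with step `h` vanishes is a polynomial along each
arithmetic progression of step `h`. -/
theorem exists_polynomial_eval_natCast_of_fwdDiff_iter_eq_zero {f : ℝ → ℝ} {h : ℝ} {n : ℕ}
    (hf : ∀ y, (fwdDiff h)^[n] f y = 0) (y : ℝ) :
    ∃ p : Polynomial ℝ, ∀ k : ℕ, f (y + k * h) = p.eval (k : ℝ) := by
  have hz : (fwdDiff h)^[n] f = 0 := funext hf
  have hj : ∀ j, n ≤ j → (fwdDiff h)^[j] f y = 0 := by
    intro j hnj
    obtain ⟨m, rfl⟩ := Nat.exists_eq_add_of_le hnj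
    rw [add_comm, Function.iterate_add_apply, hz]
    have : ∀ m : ℕ, (fwdDiff h)^[m] (0 : ℝ → ℝ) = 0 := fun m =>
      Function.iterate_fixed (by ext; simp [fwdDiff]) m
    simp [this]
  -- Newton's forward difference formula, with `k.choose j` written as a polynomial in `k`.
  refine ⟨∑ j ∈ Finset.range n, Polynomial.C ((fwdDiff h)^[j] f y / (j.factorial : ℝ)) *
    descPochhammer ℝ j, fun k => ?_⟩
  have key := shift_eq_sum_fwdDiff_iter h f k y
  rw [nsmul_eq_mul] at key
  rw [key, Polynomial.eval_finsetSum]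
  have hterm : ∀ j, (Polynomial.C ((fwdDiff h)^[j] f y / (j.factorial : ℝ)) *
      descPochhammer ℝ j).eval (k : ℝ) = k.choose j • (fwdDiff h)^[j] f y := by
    intro j
    rw [Polynomial.eval_mul, Polynomial.eval_C, descPochhammer_eval_eq_descFactorial,
      Nat.descFactorial_eq_factorial_mul_choose, nsmul_eq_mul]
    have : (j.factorial : ℝ) ≠ 0 := by positivity
    push_cast
    field_simp
  simp_rw [hterm]
  -- Both sums extend to `max (k + 1) n`: the added terms vanish through the differences if `j ≥ n`,
  -- through the binomial if `j > k`.
  rw [Finset.sum_subset (Finset.range_subset_range.2 (le_max_left (k + 1) n)),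
    Finset.sum_subset (Finset.range_subset_range.2 (le_max_right (k + 1) n))]
  · intro j _ hjn
    rw [hj j (by simpa using hjn), smul_zero]
  · intro j _ hjk
    rw [Nat.choose_eq_zero_of_lt (by simpa using hjk), zero_smul]

/-- **Fréchet's theorem**: a continuous function all of whose `n`-th differences vanish is a
polynomial. -/
theorem exists_polynomial_of_fwdDiff_iter_eq_zero {f : ℝ → ℝ} (hc : Continuous f) {n : ℕ}
    (hf : ∀ h y, (fwdDiff h)^[n] f y = 0) : ∃ p : Polynomial ℝ, ∀ x, f x = p.eval x := by
  obtain ⟨p, hp⟩ := exists_polynomial_eval_natCast_of_fwdDiff_iter_eq_zero (hf 1) 0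
  replace hp : ∀ k : ℕ, f k = p.eval (k : ℝ) := by simpa using hp
  have hlat : ∀ N q : ℕ, 0 < q → ∀ k : ℕ,
      f (-N + k * (q : ℝ)⁻¹) = p.eval (-N + k * (q : ℝ)⁻¹) := by
    intro N q hq k
    have hq' : (q : ℝ) ≠ 0 := by positivity
    obtain ⟨r, hr⟩ :=
      exists_polynomial_eval_natCast_of_fwdDiff_iter_eq_zero (hf (q : ℝ)⁻¹) (-N)
    -- The two polynomials agree at `k = q * (m + N)`, where the progression meets the natural
    -- number `m`.
    have hrp : r = p.comp (Polynomial.C (-N : ℝ) + Polynomial.X * Polynomial.C (q : ℝ)⁻¹) := by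
      apply Polynomial.eq_of_infinite_eval_eq
      refine Set.infinite_of_injective_forall_mem (f := fun m : ℕ => ((q * (m + N) : ℕ) : ℝ)) ?_ ?_
      · intro a b hab
        have := Nat.eq_of_mul_eq_mul_left hq (Nat.cast_injective hab)
        omega
      · intro m
        have e : (-N : ℝ) + ((q * (m + N) : ℕ) : ℝ) * (q : ℝ)⁻¹ = m := by
          push_cast
          field_simp
          ring
        simp only [Set.mem_ofPred_eq, ← hr, Polynomial.eval_comp, Polynomial.eval_add,
          Polynomial.eval_mul, Polynomial.eval_C, Polynomial.eval_X, e, hp]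
    rw [hr, hrp]
    simp only [Polynomial.eval_comp, Polynomial.eval_add, Polynomial.eval_mul, Polynomial.eval_C,
      Polynomial.eval_X]
  refine ⟨p, congrFun <| hc.ext_on Rat.denseRange_cast p.continuous ?_⟩
  rintro _ ⟨t, rfl⟩
  -- With `N = |t.num|` and `t.den ≥ 1`, the progression from `-N` with step `1 / t.den` reaches
  -- `t`.
  obtain ⟨N, k, hk⟩ : ∃ N k : ℕ, (k : ℤ) = t.num + N * t.den := by
    refine ⟨t.num.natAbs, (t.num + t.num.natAbs * t.den).toNat, Int.toNat_of_nonneg ?_⟩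
    have h1 : (1 : ℤ) ≤ t.den := by exact_mod_cast t.den_pos
    have h2 := neg_abs_le t.num
    rw [Int.natCast_natAbs]
    nlinarith [abs_nonneg t.num]
  have hk' : (k : ℝ) = t.num + N * t.den := by exact_mod_cast hk
  have hd : (t.den : ℝ) ≠ 0 := by exact_mod_cast t.den_ne_zero
  have e : (t : ℝ) = -(N : ℝ) + k * (t.den : ℝ)⁻¹ := by
    rw [hk', Rat.cast_def]
    field_simp
    ring
  rw [e]
  exact hlat _ _ t.den_pos k

/-- If `x` does not lie on the line of `y`, some vector orthogonal to `y` has a prescribed inner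
product with `x`. -/
theorem exists_inner_eq_and_inner_eq_zero {E : Type*} [NormedAddCommGroup E]
    [InnerProductSpace ℝ E] {x y : E} (hy : y ≠ 0) (hxy : ∀ t : ℝ, x ≠ t • y) (a : ℝ) :
    ∃ h : E, ⟪h, x⟫ = a ∧ ⟪h, y⟫ = 0 := by
  have hyy : ⟪y, y⟫ ≠ 0 := inner_self_ne_zero.2 hy
  -- `t • y` is the orthogonal projection of `x` on the line of `y`; a multiple of the residual `z`
  -- is the vector sought.
  set t : ℝ := ⟪x, y⟫ / ⟪y, y⟫ with ht
  set z : E := x - t • y with hz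
  have hz0 : z ≠ 0 := sub_ne_zero.2 (hxy t)
  have hzy : ⟪z, y⟫ = 0 := by
    rw [hz, inner_sub_left, real_inner_smul_left, ht]
    field_simp
    ring
  have hzx : ⟪z, x⟫ = ⟪z, z⟫ := by
    conv_rhs => rw [hz, inner_sub_right, inner_smul_right, ← hz, hzy]
    simp
  have hzz : ⟪z, z⟫ ≠ 0 := inner_self_ne_zero.2 hz0
  refine ⟨(a / ⟪z, z⟫) • z, ?_, ?_⟩
  · rw [real_inner_smul_left, hzx]
    field_simp
  · rw [real_inner_smul_left, hzy, mul_zero]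

/-- If a sum of ridge functions vanishes, and the direction of one of them is not parallel to any
other, then the differences of its profile of order the number of the others vanish. -/
theorem fwdDiff_iter_eq_zero_of_sum_ridge_eq_zero {ι E : Type*} [DecidableEq ι]
    [NormedAddCommGroup E] [InnerProductSpace ℝ E] (ζ : ι → E) {x : E} (hx : x ≠ 0)
    (s : Finset ι) (hs : ∀ i ∈ s, ζ i ≠ 0 ∧ ∀ t : ℝ, x ≠ t • ζ i) (g : ℝ → ℝ) (f : ι → ℝ → ℝ)
    (hsum : ∀ w, g ⟪w, x⟫ + ∑ i ∈ s, f i ⟪w, ζ i⟫ = 0) (a y : ℝ) :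
    (fwdDiff a)^[s.card] g y = 0 := by
  induction s using Finset.induction_on generalizing g f y with
  | empty =>
    have hxx : ⟪x, x⟫ ≠ 0 := inner_self_ne_zero.2 hx
    have := hsum ((y / ⟪x, x⟫) • x)
    rw [real_inner_smul_left, div_mul_cancel₀ _ hxx] at this
    simpa using this
  | insert j s hj ih =>
    obtain ⟨h, hhx, hhj⟩ := exists_inner_eq_and_inner_eq_zero
      (hs j (Finset.mem_insert_self j s)).1 (hs j (Finset.mem_insert_self j s)).2 a
    rw [Finset.card_insert_of_notMem hj, Function.iterate_succ_apply]
    -- The shift `h` changes `⟪w, x⟫` by `a` and fixes `⟪w, ζ j⟫`, so subtraction cancels `f j` and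
    -- turns `g` into `fwdDiff a g`.
    refine ih (fun i hi => hs i (Finset.mem_insert_of_mem hi)) _
      (fun i => fwdDiff ⟪h, ζ i⟫ (f i)) (fun w => ?_) y
    have h1 := hsum (w + h)
    have h2 := hsum w
    rw [Finset.sum_insert hj] at h1 h2
    simp only [inner_add_left, hhx, hhj, add_zero] at h1
    simp only [fwdDiff, Finset.sum_sub_distrib]
    linarith

/-- Ridge functions with a common continuous non-polynomial profile, in distinct directions, are
linearly independent. -/
theorem eq_zero_of_sum_mul_ridge_eq_zero {d M : ℕ} {σ : ℝ → ℝ} (hσ : Continuous σ)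
    (hσ_poly : NonPolynomial σ) {ζ : Fin M → EuclideanSpace ℝ (Fin d)}
    (hζ : InDistinctDirections ζ) {v : Fin M → ℝ} (hv : ∀ w, ∑ i, v i * σ ⟪w, ζ i⟫ = 0) :
    v = 0 := by
  by_contra hne
  obtain ⟨i, hi⟩ := Function.ne_iff.1 hne
  have hi : v i ≠ 0 := hi
  have hdiff := fwdDiff_iter_eq_zero_of_sum_ridge_eq_zero ζ (hζ.1 i) (Finset.univ.erase i)
    (fun j hj => ⟨hζ.1 j, hζ.2 i j (Finset.ne_of_mem_erase hj).symm⟩)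
    (fun t => v i * σ t) (fun j t => v j * σ t)
    (fun w => by rw [Finset.add_sum_erase _ (fun j => v j * σ ⟪w, ζ j⟫) (Finset.mem_univ i), hv w])
  obtain ⟨p, hp⟩ := exists_polynomial_of_fwdDiff_iter_eq_zero (by fun_prop) hdiff
  refine hσ_poly ⟨Polynomial.C (v i)⁻¹ * p, fun t => ?_⟩
  rw [Polynomial.eval_mul, Polynomial.eval_C, ← hp, inv_mul_cancel_left₀ hi]

/-- A continuous function of `w` that vanishes almost surely vanishes everywhere. -/
theorem HasFullInitialSupport.eq_zero_of_ae {d : ℕ} {B : ℝ} (hB : 0 < B)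
    {μ₀ : Measure (ℝ × EuclideanSpace ℝ (Fin d))} (hμ₀ : HasFullInitialSupport B μ₀)
    {F : EuclideanSpace ℝ (Fin d) → ℝ} (hF : Continuous F) (h : ∀ᵐ p ∂μ₀, F p.2 = 0)
    (w : EuclideanSpace ℝ (Fin d)) : F w = 0 := by
  by_contra hw
  have hU : IsOpen {w | F w ≠ 0} := isOpen_ne_fun hF continuous_const
  -- The cylinder over the open set `{F ≠ 0}` has positive volume because `B > 0`.
  have hpos := hμ₀.2 (Set.Icc (-B) B ×ˢ {w | F w ≠ 0}) (measurableSet_Icc.prod hU.measurableSet)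
    (Set.prod_mono le_rfl (Set.subset_univ _)) (by
      rw [Measure.volume_eq_prod, Measure.prod_prod, Real.volume_Icc]
      refine ENNReal.mul_pos ?_ (hU.measure_pos volume ⟨w, hw⟩).ne'
      simpa using by linarith)
  refine hpos.ne' (measure_mono_null (fun p hp => ?_) h)
  exact hp.2

/-- The quadratic form of the matrix as the mean of a sum of squares. -/
theorem dotProduct_limitMatrix_mulVec {d M : ℕ} (α : ℝ) (σ : ℝ → ℝ)
    (μ₀ : Measure (ℝ × EuclideanSpace ℝ (Fin d))) (ζ : Fin M → EuclideanSpace ℝ (Fin d))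
    (h_outer : ∀ i j, Integrable (outerIntegrand σ (ζ i) (ζ j)) μ₀)
    (h_inner : ∀ i j, Integrable (innerIntegrand σ (ζ i) (ζ j)) μ₀) (v : Fin M → ℝ) :
    v ⬝ᵥ (limitMatrix α σ μ₀ ζ).mulVec v =
      α * ∫ p, (∑ i, v i * σ ⟪p.2, ζ i⟫) ^ 2 ∂μ₀ +
      α * ∫ p, p.1 ^ 2 * ‖∑ i, (v i * deriv σ ⟪p.2, ζ i⟫) • ζ i‖ ^ 2 ∂μ₀ := by
  have e1 : ∀ p : ℝ × EuclideanSpace ℝ (Fin d), (∑ i, v i * σ ⟪p.2, ζ i⟫) ^ 2 =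
      ∑ i, ∑ j, v i * v j * outerIntegrand σ (ζ i) (ζ j) p := by
    intro p
    rw [sq, Finset.sum_mul_sum]
    refine Finset.sum_congr rfl fun i _ => Finset.sum_congr rfl fun j _ => ?_
    rw [outerIntegrand]
    ring
  have e2 : ∀ p : ℝ × EuclideanSpace ℝ (Fin d),
      p.1 ^ 2 * ‖∑ i, (v i * deriv σ ⟪p.2, ζ i⟫) • ζ i‖ ^ 2 =
      ∑ i, ∑ j, v i * v j * innerIntegrand σ (ζ i) (ζ j) p := by
    intro p
    rw [← real_inner_self_eq_norm_sq, sum_inner, Finset.mul_sum]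
    refine Finset.sum_congr rfl fun i _ => ?_
    rw [inner_sum, Finset.mul_sum]
    refine Finset.sum_congr rfl fun j _ => ?_
    rw [real_inner_smul_left, real_inner_smul_right, innerIntegrand]
    ring
  simp_rw [e1, e2]
  rw [integral_finsetSum _ fun i _ => integrable_finsetSum _ fun j _ =>
      (h_outer i j).const_mul _,
    integral_finsetSum _ fun i _ => integrable_finsetSum _ fun j _ =>
      (h_inner i j).const_mul _]
  simp_rw [integral_finsetSum _ fun j _ => (h_outer _ j).const_mul _,
    integral_finsetSum _ fun j _ => (h_inner _ j).const_mul _, integral_const_mul]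
  simp only [dotProduct, Matrix.mulVec, limitMatrix, Matrix.of_apply, Finset.mul_sum]
  rw [← Finset.sum_add_distrib]
  refine Finset.sum_congr rfl fun i _ => ?_
  rw [← Finset.sum_add_distrib]
  refine Finset.sum_congr rfl fun j _ => ?_
  ring

theorem limitMatrix_isHermitian {d M : ℕ} (α : ℝ) (σ : ℝ → ℝ)
    (μ₀ : Measure (ℝ × EuclideanSpace ℝ (Fin d))) (ζ : Fin M → EuclideanSpace ℝ (Fin d)) :
    (limitMatrix α σ μ₀ ζ).IsHermitian := by
  ext i j
  have h1 : outerIntegrand σ (ζ j) (ζ i) = outerIntegrand σ (ζ i) (ζ j) := by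
    ext p
    simp only [outerIntegrand, mul_comm]
  have h2 : innerIntegrand σ (ζ j) (ζ i) = innerIntegrand σ (ζ i) (ζ j) := by
    ext p
    simp only [innerIntegrand, real_inner_comm (ζ j) (ζ i)]
    ring
  simp only [Matrix.conjTranspose_apply, limitMatrix, Matrix.of_apply, h1, h2, star_trivial]

theorem mainTheorem6 {d M : ℕ} (α : ℝ) (hα : 0 < α) (B : ℝ) (hB : 0 < B)
    (σ : ℝ → ℝ) (hσ : Differentiable ℝ σ) (hσ_poly : NonPolynomial σ)
    (hσ_slow : SlowlyIncreasing σ)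
    (μ₀ : Measure (ℝ × EuclideanSpace ℝ (Fin d))) [IsProbabilityMeasure μ₀]
    (hμ₀ : HasFullInitialSupport B μ₀)
    (ζ : Fin M → EuclideanSpace ℝ (Fin d)) (hζ : InDistinctDirections ζ)
    (h_outer : ∀ i j, Integrable (outerIntegrand σ (ζ i) (ζ j)) μ₀)
    (h_inner : ∀ i j, Integrable (innerIntegrand σ (ζ i) (ζ j)) μ₀) :
    (limitMatrix α σ μ₀ ζ).PosDef := by
  refine Matrix.PosDef.of_dotProduct_mulVec_pos (limitMatrix_isHermitian α σ μ₀ ζ) fun v hv => ?_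
  rw [star_trivial, dotProduct_limitMatrix_mulVec α σ μ₀ ζ h_outer h_inner]
  -- Needed to pass from zero mean to zero almost surely: the integral of a non-integrable function
  -- is zero by default.
  have hint : Integrable (fun p : ℝ × EuclideanSpace ℝ (Fin d) =>
      (∑ i, v i * σ ⟪p.2, ζ i⟫) ^ 2) μ₀ := by
    refine (integrable_finsetSum Finset.univ fun i _ => integrable_finsetSum Finset.univ
      fun j _ => (h_outer i j).const_mul (v i * v j)).congr (ae_of_all _ fun p => ?_)
    simp only [sq, Finset.sum_mul_sum, outerIntegrand]
    refine Finset.sum_congr rfl fun i _ => Finset.sum_congr rfl fun j _ => ?_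
    ring
  have hpos : 0 < ∫ p, (∑ i, v i * σ ⟪p.2, ζ i⟫) ^ 2 ∂μ₀ := by
    refine (integral_nonneg fun p => sq_nonneg _).lt_of_ne' fun h0 => hv ?_
    rw [integral_eq_zero_iff_of_nonneg (fun p => sq_nonneg _) hint] at h0
    have hσc := hσ.continuous
    refine eq_zero_of_sum_mul_ridge_eq_zero hσc hσ_poly hζ
      (hμ₀.eq_zero_of_ae hB (by fun_prop) ?_)
    filter_upwards [h0] with p hp
    exact pow_eq_zero_iff two_ne_zero |>.1 hp
  have hnonneg : 0 ≤ ∫ p, p.1 ^ 2 * ‖∑ i, (v i * deriv σ ⟪p.2, ζ i⟫) • ζ i‖ ^ 2 ∂μ₀ :=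
    integral_nonneg fun p => by positivity
  exact add_pos_of_pos_of_nonneg (mul_pos hα hpos) (mul_nonneg hα.le hnonneg)
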